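/- Let $q\ge 1$ be an integer, $0<\alpha<1$, and let $f_X$ be a (measurable, not necessarily continuous) probability density on $\mathbb R$ with $\int x^{2q}f_X(x)\,dx<\infty$. A subsampling design of mass $\alpha$ is a measure $\xi$ on $\mathbb R$ with $\xi(\mathbb R)=\alpha$ that has a density $f_\xi$ satisfying $0\le f_\xi(x)\le f_X(x)$ for all $x\in\mathbb R$. For $f(x)=(1,x,\dots,x^q)^\top$ let $M(\xi)=\int f(x)f(x)^\top\,\xi(dx)$ be the information matrix of $\xi$, and let $\psi(x,\xi)=\alpha f(x)^\top M(\xi)^{-1}f(x)$ be its sensitivity function. A subsampling design of mass $\alpha$ is called $D$-optimal if it maximizes $\log\det M(\xi)$ among all subsampling designs $\xi$ of mass $\alpha$. **Theorem.** A subsampling design $\xi^*$ of mass $\alpha$ is $D$-optimal if and only if there exist a threshold $s^*\in\mathbb R$, an integer $r$ with $1\le r\le q$, and real numbers $$a_1>a_2\ge a_3>a_4\ge a_5>\dots\ge a_{2r-1}>a_{2r}$$ such that, with $\mathcal I_0=[a_1,\infty)$, $\mathcal I_r=(-\infty,a_{2r}]$, $\mathcal I_k=[a_{2k+1},a_{2k}]$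 for $1\le k\le r-1$, and $\mathcal X^*=\bigcup_{k=0}^r\mathcal I_k$, the $r+1$ intervals $\mathcal I_0,\dots,\mathcal I_r$ are mutually disjoint and 1. $\xi^*$ has the density $f_{\xi^*}(x)=f_X(x)$ for $x\in\mathcal X^*$ and $f_{\xi^*}(x)=0$ for $x\notin\mathcal X^*$; 2. $\psi(x,\xi^*)\ge s^*$ for all $x\in\mathcal X^*$; 3. $\psi(x,\xi^*)<s^*$ for all $x\notin\mathcal X^*$. (The bounded intervals $\mathcal I_k$, $1\le k\le r-1$, are allowed to consist of a single point.) -/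

import Mathlib

open MeasureTheory Set

noncomputable section

/-- The vector of regression functions `(1, x, …, x ^ q)` of polynomial regression of degree `q`. -/
def regressionVector (q : ℕ) (x : ℝ) : Fin (q + 1) → ℝ := fun j => x ^ (j : ℕ)

/-- A continuous subsampling design of mass `α` bounded by the covariate density `fX`: a measure on
the real line of total mass `α` having a density `f` with `0 ≤ f ≤ fX`. -/
structure IsSubsamplingDesign (fX : ℝ → ℝ) (α : ℝ) (ξ : Measure ℝ) : Prop where
  exists_density : ∃ f : ℝ → ℝ, Measurable f ∧ (∀ x, 0 ≤ f x) ∧ (∀ x, f x ≤ fX x) ∧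
    ξ = volume.withDensity (fun x => ENNReal.ofReal (f x))
  mass_eq : ξ univ = ENNReal.ofReal α

/-- The information matrix, the entrywise integral of the rank one matrices `f(x) f(x)ᵀ`
with respect to the design. -/
def informationMatrix (q : ℕ) (ξ : Measure ℝ) : Matrix (Fin (q + 1)) (Fin (q + 1)) ℝ :=
  Matrix.of fun i j => ∫ x, regressionVector q x i * regressionVector q x j ∂ξ

/-- The D-criterion, to be maximized. -/
def dCriterion (q : ℕ) (ξ : Measure ℝ) : ℝ := Real.log (informationMatrix q ξ).det

/-- D-optimality among all subsampling designs of mass `α` bounded by `fX`. -/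
def IsDOptimal (q : ℕ) (fX : ℝ → ℝ) (α : ℝ) (ξ : Measure ℝ) : Prop :=
  IsSubsamplingDesign fX α ξ ∧
    ∀ η : Measure ℝ, IsSubsamplingDesign fX α η → dCriterion q η ≤ dCriterion q ξ

/-- The sensitivity function `ψ(x, ξ) = α f(x)ᵀ M(ξ)⁻¹ f(x)`. -/
def sensitivity (q : ℕ) (α : ℝ) (ξ : Measure ℝ) (x : ℝ) : ℝ :=
  α * (regressionVector q x ⬝ᵥ ((informationMatrix q ξ)⁻¹.mulVec (regressionVector q x)))

/-- The `k`-th interval (for `0 ≤ k ≤ r`) determined by boundary points `a 1, …, a (2 * r)`: the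
upper tail for `k = 0`, the lower tail for `k = r`, a compact interval in between. -/
def supportInterval (r : ℕ) (a : ℕ → ℝ) (k : ℕ) : Set ℝ :=
  if k = 0 then Ici (a 1)
  else if k = r then Iic (a (2 * r))
  else Icc (a (2 * k + 1)) (a (2 * k))

/-- The union of the intervals with indices `0, …, r`. -/
def supportSet (r : ℕ) (a : ℕ → ℝ) : Set ℝ := ⋃ k ∈ Iic r, supportInterval r a k

/-- The ordering `a 1 > a 2 ≥ a 3 > a 4 ≥ … ≥ a (2 * r - 1) > a (2 * r)` of the boundary points:
consecutive intervals are separated by nonempty gaps, while a bounded interval may consist of a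
single point. -/
def IsBoundary (r : ℕ) (a : ℕ → ℝ) : Prop :=
  (∀ k, k < r → a (2 * k + 2) < a (2 * k + 1)) ∧
    (∀ k, 1 ≤ k → k < r → a (2 * k + 1) ≤ a (2 * k))

end

/-! The criterion `log det` is concave, and its derivative at `M(ξ)` towards `M(η)` is `tr(M(ξ)⁻¹
(M(η) - M(ξ)))`. Since `α tr(M(ξ)⁻¹ M(η)) = ∫ ψ(x, ξ) dη`, a design `ξ` is D-optimal iff it
maximises the linear functional `η ↦ ∫ ψ(x, ξ) dη` over all designs
(`IsDOptimal.integral_sensitivity_le`, `isDOptimal_of_integral_sensitivity_le`).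

With densities confined to `0 ≤ g ≤ fX` and fixed mass, this is a bathtub problem: put all of `fX`
where `ψ ≥ s` and nothing elsewhere. As `ψ` is a polynomial of degree `2q` with positive leading
coefficient, its level sets are null. Hence some `s` gives mass exactly `α`
(`exists_integral_indicator_superlevel_eq`), and the maximiser is unique almost everywhere
(`ae_eq_indicator_of_integral_le`).

The shape of the support comes from counting roots: each component of `{ψ < s}` uses up two of the
`2q` roots of `ψ - s`, so there are at most `q` such gaps
(`Polynomial.exists_boundary_of_eval_neg`). Two gaps meeting at a multiple root leave a single-point
interval between them. -/

/-! ### Where a real polynomial is negative. -/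

open Polynomial Filter in
-- The root is the infimum of the points to the right of `x` where `p ≥ 0`; such points exist
-- because `p` tends to `+∞`.
theorem Polynomial.exists_gt_isRoot_of_eval_neg {p : ℝ[X]} (hdeg : 0 < p.degree)
    (hlead : 0 < p.leadingCoeff) {x : ℝ} (hx : p.eval x < 0) :
    ∃ c, x < c ∧ p.eval c = 0 ∧ ∀ y ∈ Ico x c, p.eval y < 0 := by
  let S : Set ℝ := {y | x ≤ y ∧ 0 ≤ p.eval y}
  have hS : IsClosed S := isClosed_Ici.inter (isClosed_le continuous_const p.continuous)
  have hne : S.Nonempty := by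
    obtain ⟨y, h1, h2⟩ := ((tendsto_atTop_of_leadingCoeff_nonneg p hdeg hlead.le).eventually_ge_atTop
      0 |>.and (eventually_ge_atTop x)).exists
    exact ⟨y, h2, h1⟩
  have hbdd : BddBelow S := ⟨x, fun y hy => hy.1⟩
  obtain ⟨hxc, hc⟩ := hS.csInf_mem hne hbdd
  set c := sInf S
  have hneg : ∀ y ∈ Ico x c, p.eval y < 0 := fun y hy => by
    by_contra! h
    exact absurd (csInf_le hbdd (show y ∈ S from ⟨hy.1, h⟩)) (not_le.2 hy.2)
  have hlt : x < c := lt_of_le_of_ne hxc (by rintro h; rw [← h] at hc; linarith)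
  refine ⟨c, hlt, le_antisymm ?_ hc, hneg⟩
  obtain ⟨z, hz, hz0⟩ := intermediate_value_Icc hxc p.continuous.continuousOn ⟨hx.le, hc⟩
  rcases hz.2.lt_or_eq with h | h
  · exact absurd hz0 (hneg z ⟨hz.1, h⟩).ne
  · rw [← h]; exact hz0.le

-- Reflection `x ↦ -x` of the previous lemma; even degree preserves the leading coefficient.
open Polynomial in
theorem Polynomial.exists_lt_isRoot_of_eval_neg {p : ℝ[X]} (hdeg : 0 < p.degree)
    (heven : Even p.natDegree) (hlead : 0 < p.leadingCoeff) {x : ℝ} (hx : p.eval x < 0) :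
    ∃ b, b < x ∧ p.eval b = 0 ∧ ∀ y ∈ Ioc b x, p.eval y < 0 := by
  have hnd : (p.comp (-X)).natDegree = p.natDegree := by simp [natDegree_comp]
  have hl : (p.comp (-X)).leadingCoeff = p.leadingCoeff := by
    rw [leadingCoeff_comp (by simp)]; simp [heven.neg_one_pow]
  obtain ⟨c, hc, hc0, h⟩ := Polynomial.exists_gt_isRoot_of_eval_neg (p := p.comp (-X)) (x := -x)
    (natDegree_pos_iff_degree_pos.1 (hnd ▸ natDegree_pos_iff_degree_pos.2 hdeg)) (hl ▸ hlead)
    (by simpa using hx)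
  refine ⟨-c, by linarith, by simpa using hc0, fun y hy => ?_⟩
  simpa using h (-y) ⟨by linarith [hy.2], by linarith [hy.1]⟩

open Polynomial in
/-- The uppermost connected component of the region where a polynomial is negative. -/
theorem Polynomial.exists_uppermost_neg_interval {p : ℝ[X]} (hdeg : 0 < p.degree)
    (heven : Even p.natDegree) (hlead : 0 < p.leadingCoeff) {x : ℝ} (hx : p.eval x < 0) :
    ∃ b c, b < c ∧ p.eval b = 0 ∧ p.eval c = 0 ∧ (∀ y ∈ Ioo b c, p.eval y < 0) ∧
      ∀ y, c ≤ y → 0 ≤ p.eval y := by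
  have hp : p ≠ 0 := by rintro rfl; simp at hlead
  -- Right endpoints of negative stretches. They are roots, hence finitely many, and the largest one
  -- closes the uppermost gap.
  let R : Set ℝ := {c | p.eval c = 0 ∧ ∃ x < c, ∀ y ∈ Ico x c, p.eval y < 0}
  have hfin : R.Finite := (p.finite_setOfPred_isRoot hp).subset fun c hc => hc.1
  obtain ⟨c₀, h₀, h₁, h₂⟩ := Polynomial.exists_gt_isRoot_of_eval_neg hdeg hlead hx
  obtain ⟨c, ⟨hc0, x', hx', hneg⟩, hmax⟩ :=
    hfin.exists_maximal ⟨c₀, h₁, x, h₀, h₂⟩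
  obtain ⟨b, hb, hb0, hneg'⟩ := Polynomial.exists_lt_isRoot_of_eval_neg hdeg heven hlead
    (hneg x' ⟨le_rfl, hx'⟩)
  refine ⟨b, c, hb.trans hx', hb0, hc0, fun y hy => ?_, fun y hy => ?_⟩
  · rcases le_total y x' with h | h
    · exact hneg' y ⟨hy.1, h⟩
    · exact hneg y ⟨h, hy.2⟩
  · by_contra! h
    obtain ⟨d, hd, hd0, hd'⟩ := Polynomial.exists_gt_isRoot_of_eval_neg hdeg hlead h
    have := hmax (show d ∈ R from ⟨hd0, y, hd, hd'⟩) (by linarith)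
    linarith

open Polynomial in
/-- A polynomial of degree `2 * n` with positive leading coefficient is negative on at most `n`
open intervals. -/
theorem Polynomial.exists_boundary_of_eval_neg (n : ℕ) : ∀ {p : ℝ[X]}, p.natDegree = 2 * n →
    0 < p.leadingCoeff → (∃ x, p.eval x < 0) →
    ∃ (r : ℕ) (a : ℕ → ℝ), 1 ≤ r ∧ r ≤ n ∧ IsBoundary r a ∧
      ∀ x, p.eval x < 0 ↔ ∃ k < r, a (2 * k + 2) < x ∧ x < a (2 * k + 1) := by
  induction n with
  | zero =>
    rintro p hdeg hlead ⟨x, hx⟩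
    rw [eq_C_of_natDegree_eq_zero (p := p) (by simpa using hdeg)] at hx hlead
    simp at hx hlead
    linarith
  | succ n ih =>
    rintro p hdeg hlead ⟨x, hx⟩
    obtain ⟨b, c, hbc, hb, hc, hneg, hup⟩ := Polynomial.exists_uppermost_neg_interval
      (natDegree_pos_iff_degree_pos.1 (by omega)) (by rw [hdeg]; exact even_two_mul _) hlead hx
    -- Divide out both endpoints of the uppermost gap: the quotient `g` has degree `2 * n`, and its
    -- negative set is the rest of that of `p`.
    obtain ⟨g₁, rfl⟩ := dvd_iff_isRoot.2 hb
    have hg₁ : g₁.eval c = 0 := by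
      rw [eval_mul] at hc
      refine (mul_eq_zero.1 hc).resolve_left ?_
      simp [sub_eq_zero, hbc.ne']
    obtain ⟨g, rfl⟩ := dvd_iff_isRoot.2 hg₁
    have hg0 : g ≠ 0 := by rintro rfl; simp at hlead
    have hgdeg : g.natDegree = 2 * n := by
      rw [natDegree_mul (X_sub_C_ne_zero _) (mul_ne_zero (X_sub_C_ne_zero _) hg0),
        natDegree_mul (X_sub_C_ne_zero _) hg0, natDegree_X_sub_C, natDegree_X_sub_C] at hdeg
      omega
    have hglead : 0 < g.leadingCoeff := by simpa [leadingCoeff_mul] using hlead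
    have heval : ∀ y, ((X - C b) * ((X - C c) * g)).eval y = (y - b) * (y - c) * g.eval y := by
      intro y; simp [mul_assoc]
    simp only [heval] at hneg hup ⊢
    have hin : ∀ y ∈ Ioo b c, 0 < g.eval y := fun y hy =>
      pos_of_mul_neg_right (hneg y hy)
        (mul_neg_of_pos_of_neg (by linarith [hy.1]) (by linarith [hy.2])).le
    -- `b` and `c` may be multiple roots of the product, so at the endpoints only the weak
    -- inequality survives, by continuity.
    have hincl : ∀ y ∈ Icc b c, 0 ≤ g.eval y := by
      have : closure (Ioo b c) ⊆ {y | 0 ≤ g.eval y} :=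
        closure_minimal (fun y hy => (hin y hy).le) (isClosed_le continuous_const g.continuous)
      rwa [closure_Ioo hbc.ne] at this
    have hgneg : ∀ y, g.eval y < 0 → y < b := by
      intro y hy
      by_contra! h
      rcases le_or_gt y c with h' | h'
      · exact absurd (hincl y ⟨h, h'⟩) (not_le.2 hy)
      · have := hup y h'.le
        have h2 : (y - b) * (y - c) * g.eval y < 0 :=
          mul_neg_of_pos_of_neg (mul_pos (by linarith) (by linarith)) hy
        linarith
    have key : ∀ y, (y - b) * (y - c) * g.eval y < 0 ↔ (b < y ∧ y < c) ∨ g.eval y < 0 := by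
      intro y
      constructor
      · intro h
        by_cases hy : b < y ∧ y < c
        · exact Or.inl hy
        · refine Or.inr (neg_of_mul_neg_right h ?_)
          rcases le_or_gt y b with h1 | h1
          · exact mul_nonneg_of_nonpos_of_nonpos (by linarith) (by linarith)
          · have : c ≤ y := by by_contra! h2; exact hy ⟨h1, h2⟩
            exact mul_nonneg (by linarith) (by linarith)
      · rintro (h | h)
        · exact hneg y h
        · have := hgneg y h
          exact mul_neg_of_pos_of_neg (mul_pos_of_neg_of_neg (by linarith) (by linarith)) h
    simp only [key]
    by_cases hex : ∃ y, g.eval y < 0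
    · obtain ⟨r, a, hr1, hrn, ⟨ha1, ha2⟩, hiff⟩ := ih hgdeg hglead hex
      -- The top gap of `g` lies left of `b`. Equality can occur and yields a one-point interval.
      have ha : a 1 ≤ b := by
        have h2 : Ioo (a 2) (a 1) ⊆ Iic b := fun y hy =>
          (hgneg y ((hiff y).2 ⟨0, by omega, hy.1, hy.2⟩)).le
        have h3 := closure_minimal h2 isClosed_Iic
        have h4 : a 2 < a 1 := ha1 0 (by omega)
        rw [closure_Ioo h4.ne] at h3
        exact h3 ⟨h4.le, le_rfl⟩
      -- The new gap `(b, c)` takes indices 2 and 1, and the old endpoints shift by two. The value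
      -- at index 0 is never read.
      refine ⟨r + 1, fun k => if k = 1 then c else if k = 2 then b else a (k - 2), by omega,
        by omega, ⟨fun k hk => ?_, fun k hk hk' => ?_⟩, fun y => ?_⟩
      · rcases k with _ | k
        · simpa using hbc
        · simpa [mul_add] using ha1 k (by omega)
      · obtain ⟨k, rfl⟩ : ∃ l, k = l + 1 := ⟨k - 1, by omega⟩
        rcases k with _ | k
        · simpa using ha
        · simpa [mul_add] using ha2 (k + 1) (by omega) (by omega)
      · rw [hiff]
        constructor
        · rintro (h | ⟨k, hk, h⟩)
          · exact ⟨0, by omega, by simpa using h⟩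
          · exact ⟨k + 1, by omega, by simpa [mul_add] using h⟩
        · rintro ⟨k, hk, h⟩
          rcases k with _ | k
          · exact Or.inl (by simpa using h)
          · exact Or.inr ⟨k, by omega, by simpa [mul_add] using h⟩
    · push Not at hex
      refine ⟨1, fun k => if k = 1 then c else b, le_rfl, by omega,
        ⟨fun k hk => ?_, fun k _ _ => by omega⟩,
        fun y => ?_⟩
      · obtain rfl : k = 0 := by omega
        simpa using hbc
      · constructor
        · rintro (h | h)
          · exact ⟨0, one_pos, by simpa using h⟩
          · exact absurd h (not_lt.2 (hex y))
        · rintro ⟨k, hk, h⟩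
          obtain rfl : k = 0 := by omega
          exact Or.inl (by simpa using h)

/-! ### Order structure of the support intervals. -/

theorem IsBoundary.antitone {r : ℕ} {a : ℕ → ℝ} (ha : IsBoundary r a) {i j : ℕ} (hi : 1 ≤ i)
    (hij : i ≤ j) (hj : j ≤ 2 * r) : a j ≤ a i := by
  induction j, hij using Nat.le_induction with
  | base => exact le_rfl
  | succ j hij ih =>
    refine le_trans ?_ (ih (by omega))
    rcases Nat.even_or_odd' j with ⟨k, rfl | rfl⟩
    · exact ha.2 k (by omega) (by omega)
    · exact (ha.1 k (by omega)).le

theorem mem_supportSet_iff {r : ℕ} {a : ℕ → ℝ} (hr : 1 ≤ r) {x : ℝ} :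
    x ∈ supportSet r a ↔ a 1 ≤ x ∨ x ≤ a (2 * r) ∨
      ∃ k, 1 ≤ k ∧ k < r ∧ a (2 * k + 1) ≤ x ∧ x ≤ a (2 * k) := by
  simp only [supportSet, mem_iUnion, mem_Iic, exists_prop, supportInterval]
  constructor
  · rintro ⟨k, hk, h⟩
    split_ifs at h with h0 h1
    · exact Or.inl h
    · exact Or.inr (Or.inl h)
    · exact Or.inr (Or.inr ⟨k, by omega, by omega, h⟩)
  · rintro (h | h | ⟨k, h1, h2, h⟩)
    · exact ⟨0, by omega, by simpa using h⟩
    · exact ⟨r, le_rfl, by simpa [show r ≠ 0 by omega] using h⟩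
    · exact ⟨k, h2.le, by simpa [show k ≠ 0 by omega, h2.ne] using h⟩

/-- The complement of the support consists of the open gaps between consecutive intervals. -/
theorem IsBoundary.notMem_supportSet_iff {r : ℕ} {a : ℕ → ℝ} (ha : IsBoundary r a) (hr : 1 ≤ r)
    {x : ℝ} : x ∉ supportSet r a ↔ ∃ k < r, a (2 * k + 2) < x ∧ x < a (2 * k + 1) := by
  classical
  rw [mem_supportSet_iff hr]
  push Not
  constructor
  · rintro ⟨h1, h2, h3⟩
    -- The gap containing `x` is the first one whose lower end is below `x`: were `x` not below its
    -- upper end too, `x` would lie in the closed interval above that gap or contradict minimality.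
    have hex : ∃ k, k < r ∧ a (2 * k + 2) < x :=
      ⟨r - 1, by omega, by rwa [show 2 * (r - 1) + 2 = 2 * r by omega]⟩
    obtain ⟨hk, hkx⟩ := Nat.find_spec hex
    refine ⟨Nat.find hex, hk, hkx, ?_⟩
    rcases hm : Nat.find hex with _ | m
    · simpa using h1
    · have hmin := Nat.find_min hex (m := m) (by omega)
      by_contra! h
      have h4 := h3 (m + 1) (by omega) (by omega) h
      exact hmin ⟨by omega, by simpa [mul_add] using h4⟩
  · rintro ⟨k, hk, h1, h2⟩
    refine ⟨h2.trans_le (ha.antitone le_rfl (by omega) (by omega)),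
      (ha.antitone (by omega) (by omega) le_rfl).trans_lt h1, fun j hj1 hj h => ?_⟩
    rcases le_or_gt j k with hjk | hjk
    · have := ha.antitone (i := 2 * j + 1) (j := 2 * k + 1) (by omega) (by omega) (by omega)
      linarith
    · exact (ha.antitone (i := 2 * k + 2) (j := 2 * j) (by omega) (by omega) (by omega)).trans_lt h1

/-- For `i < j` the strict gap `a (2 * i + 2) < a (2 * i + 1)` separates interval `i` from
everything below it. -/
theorem IsBoundary.pairwiseDisjoint {r : ℕ} {a : ℕ → ℝ} (ha : IsBoundary r a) :
    (Iic r).PairwiseDisjoint (supportInterval r a) := by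
  have hlow : ∀ k < r, ∀ x ∈ supportInterval r a k, a (2 * k + 1) ≤ x := by
    intro k hk x hx
    simp only [supportInterval] at hx
    split_ifs at hx with h0 h1
    · subst h0; exact hx
    · omega
    · exact hx.1
  have hhigh : ∀ k, 0 < k → ∀ x ∈ supportInterval r a k, x ≤ a (2 * k) := by
    intro k hk x hx
    simp only [supportInterval] at hx
    split_ifs at hx with h0 h1
    · omega
    · subst h1; exact hx
    · exact hx.2
  have hdisj : ∀ i j, i < j → j ≤ r →
      Disjoint (supportInterval r a i) (supportInterval r a j) := by
    intro i j hij hj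
    refine disjoint_left.2 fun x hi hj' => ?_
    have h1 := hlow i (by omega) x hi
    have h2 := hhigh j (by omega) x hj'
    have h3 := ha.1 i (by omega)
    have h4 := ha.antitone (i := 2 * i + 2) (j := 2 * j) (by omega) (by omega) (by omega)
    linarith
  intro i hi j hj hij
  rcases lt_or_gt_of_ne hij with h | h
  · exact hdisj i j h hj
  · exact (hdisj j i h hi).symm

theorem measurableSet_supportSet (r : ℕ) (a : ℕ → ℝ) : MeasurableSet (supportSet r a) := by
  refine MeasurableSet.biUnion (to_countable _) fun k _ => ?_
  unfold supportInterval
  split_ifs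
  exacts [measurableSet_Ici, measurableSet_Iic, measurableSet_Icc]

/-! ### Concavity and first order condition for the determinant. -/

/-- The gradient inequality for the concave function `log det`. -/
theorem Matrix.PosDef.log_det_le {n : Type*} [Fintype n] [DecidableEq n] {M N : Matrix n n ℝ}
    (hM : M.PosDef) (hN : N.PosDef) :
    Real.log N.det ≤ Real.log M.det + (M⁻¹ * N).trace - Fintype.card n := by
  -- With `K = B N Bᴴ` one has `det K = det N / det M` and `tr K = tr (M⁻¹ N)`, so the claim becomes
  -- `log λ ≤ λ - 1` summed over the eigenvalues of `K`.
  obtain ⟨B, hB⟩ : ∃ B : Matrix n n ℝ, M⁻¹ = B.conjTranspose * B := by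
    open scoped MatrixOrder Matrix.Norms.L2Operator in
    exact CStarAlgebra.nonneg_iff_eq_star_mul_self.1 hM.inv.posSemidef.nonneg
  have hBdet : B.det * B.det = M.det⁻¹ := by
    have := congrArg Matrix.det hB
    rw [Matrix.det_nonsing_inv, Matrix.det_mul, Matrix.det_conjTranspose, Ring.inverse_eq_inv',
      star_trivial] at this
    exact this.symm
  have hB0 : B.det ≠ 0 := by
    intro h
    have := inv_pos.2 hM.det_pos
    rw [← hBdet, h] at this
    simp at this
  have hBu : IsUnit B := (Matrix.isUnit_iff_isUnit_det B).2 hB0.isUnit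
  have hK : (B * N * B.conjTranspose).PosDef :=
    hN.mul_mul_conjTranspose_same (Matrix.vecMul_injective_of_isUnit hBu)
  have htr : (M⁻¹ * N).trace = (B * N * B.conjTranspose).trace := by
    rw [hB, Matrix.mul_assoc, Matrix.trace_mul_comm]
  have hdet : (B * N * B.conjTranspose).det = N.det / M.det := by
    rw [Matrix.det_mul, Matrix.det_mul, Matrix.det_conjTranspose, star_trivial, div_eq_mul_inv,
      ← hBdet]
    ring
  have hlog : Real.log (B * N * B.conjTranspose).det ≤
      (B * N * B.conjTranspose).trace - Fintype.card n := by
    rw [hK.isHermitian.det_eq_prod_eigenvalues, hK.isHermitian.trace_eq_sum_eigenvalues]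
    simp only [RCLike.ofReal_real_eq_id, id]
    rw [Real.log_prod fun i _ => (hK.eigenvalues_pos i).ne']
    calc _ ≤ ∑ i, (hK.isHermitian.eigenvalues i - 1) :=
          Finset.sum_le_sum fun i _ => Real.log_le_sub_one_of_pos (hK.eigenvalues_pos i)
      _ = _ := by simp [Finset.sum_sub_distrib]
  rw [hdet, Real.log_div hN.det_pos.ne' hM.det_pos.ne', ← htr] at hlog
  linarith

/-- First order condition for a maximum of the determinant on a segment. -/
theorem Matrix.trace_inv_mul_sub_nonpos_of_det_le {n : Type*} [Fintype n] [DecidableEq n]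
    {M N : Matrix n n ℝ} (hM : 0 < M.det)
    (h : ∀ t ∈ Ioo (0 : ℝ) 1, (M + t • (N - M)).det ≤ M.det) : (M⁻¹ * (N - M)).trace ≤ 0 := by
  set D := M⁻¹ * (N - M)
  have hfac : ∀ t : ℝ, M + t • (N - M) = M * (1 + t • D) := fun t => by
    rw [Matrix.mul_add, Matrix.mul_one, Matrix.mul_smul,
      Matrix.mul_nonsing_inv_cancel_left _ _ hM.ne'.isUnit]
  -- `P` is the remainder in `det (1 + t D) = 1 + t tr D + t² P(t)`. Dividing by `t` and letting `t
  -- → 0` leaves `tr D ≤ 0`.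
  set P := (1 + (Polynomial.X : Polynomial ℝ) • D.map Polynomial.C).det.divX.divX
  have hle : ∀ t ∈ Ioo (0 : ℝ) 1, D.trace + P.eval t * t ≤ 0 := fun t ht => by
    have h1 := h t ht
    rw [hfac, Matrix.det_mul, Matrix.det_one_add_smul] at h1
    have h2 : 1 + D.trace * t + P.eval t * t ^ 2 ≤ 1 := by
      by_contra! h3
      nlinarith [mul_lt_mul_of_pos_left h3 hM]
    have h3 : (D.trace + P.eval t * t) * t ≤ 0 := by linarith
    exact nonpos_of_mul_nonpos_left h3 ht.1
  have hcont : Continuous fun t : ℝ => D.trace + P.eval t * t := by fun_prop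
  have hcl : closure (Ioo (0 : ℝ) 1) ⊆ {t | D.trace + P.eval t * t ≤ 0} :=
    closure_minimal hle (isClosed_le hcont continuous_const)
  rw [closure_Ioo zero_ne_one] at hcl
  simpa using hcl ⟨le_rfl, zero_le_one⟩

/-! ### Integrals and moments under a density. -/

theorem integral_withDensity_ofReal {f : ℝ → ℝ} (hf : Measurable f) (h0 : ∀ x, 0 ≤ f x)
    (g : ℝ → ℝ) :
    ∫ x, g x ∂(volume.withDensity fun x => ENNReal.ofReal (f x)) = ∫ x, f x * g x := by
  rw [integral_withDensity_eq_integral_toReal_smul hf.ennreal_ofReal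
    (Filter.Eventually.of_forall fun _ => ENNReal.ofReal_lt_top)]
  simp [ENNReal.toReal_ofReal (h0 _)]

theorem integrable_withDensity_ofReal_iff {f : ℝ → ℝ} (hf : Measurable f) (h0 : ∀ x, 0 ≤ f x)
    {g : ℝ → ℝ} :
    Integrable g (volume.withDensity fun x => ENNReal.ofReal (f x)) ↔
      Integrable (fun x => f x * g x) volume := by
  rw [integrable_withDensity_iff_integrable_smul' hf.ennreal_ofReal
    (Filter.Eventually.of_forall fun _ => ENNReal.ofReal_lt_top)]
  simp [ENNReal.toReal_ofReal (h0 _)]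

theorem withDensity_ofReal_univ {f : ℝ → ℝ} (h0 : ∀ x, 0 ≤ f x) (hf : Integrable f) :
    (volume.withDensity fun x => ENNReal.ofReal (f x)) univ = ENNReal.ofReal (∫ x, f x) := by
  rw [withDensity_apply _ MeasurableSet.univ, Measure.restrict_univ,
    ofReal_integral_eq_lintegral_ofReal hf (Filter.Eventually.of_forall h0)]

theorem Polynomial.integrable_eval_of_moments {μ : Measure ℝ} {n : ℕ}
    (hμ : ∀ k ≤ n, Integrable (fun x => x ^ k) μ) {p : Polynomial ℝ} (hp : p.natDegree ≤ n) :
    Integrable (fun x => p.eval x) μ := by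
  simp only [Polynomial.eval_eq_sum_range]
  exact integrable_finsetSum _ fun i hi =>
    (hμ i (by have := Finset.mem_range.1 hi; omega)).const_mul _

theorem integrable_mul_pow {f : ℝ → ℝ} {n : ℕ} (hf : Measurable f) (h0 : ∀ x, 0 ≤ f x)
    (hint : Integrable f) (hmom : Integrable fun x => x ^ (2 * n) * f x) {k : ℕ}
    (hk : k ≤ 2 * n) : Integrable fun x => f x * x ^ k := by
  refine (hint.add hmom).mono' (by fun_prop) (Filter.Eventually.of_forall fun x => ?_)
  rw [Real.norm_eq_abs, abs_mul, abs_of_nonneg (h0 x), abs_pow]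
  have h1 : |x| ^ k ≤ 1 + x ^ (2 * n) := by
    have h2 : x ^ (2 * n) = |x| ^ (2 * n) := by rw [pow_mul, pow_mul, sq_abs]
    rw [h2]
    rcases le_total |x| 1 with h | h
    · have := pow_le_one₀ (n := k) (abs_nonneg x) h
      have := pow_nonneg (abs_nonneg x) (2 * n)
      linarith
    · have := pow_le_pow_right₀ h hk
      linarith
  have := mul_le_mul_of_nonneg_left h1 (h0 x)
  simp only [Pi.add_apply]
  linarith

/-! ### The sensitivity function as a polynomial; the information matrix. -/

open Polynomial in
/-- The quadratic form of a matrix at the regression vector, as a polynomial. -/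
noncomputable def Matrix.regressionPolynomial {q : ℕ} (A : Matrix (Fin (q + 1)) (Fin (q + 1)) ℝ) :
    Polynomial ℝ :=
  ∑ i, ∑ j, C (A i j) * X ^ ((i : ℕ) + j)

theorem Matrix.eval_regressionPolynomial {q : ℕ} (A : Matrix (Fin (q + 1)) (Fin (q + 1)) ℝ)
    (x : ℝ) : A.regressionPolynomial.eval x =
      regressionVector q x ⬝ᵥ A.mulVec (regressionVector q x) := by
  simp only [Matrix.regressionPolynomial, Polynomial.eval_finsetSum, Polynomial.eval_mul,
    Polynomial.eval_C, Polynomial.eval_pow, Polynomial.eval_X, dotProduct, Matrix.mulVec,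
    regressionVector, Finset.mul_sum]
  exact Finset.sum_congr rfl fun i _ => Finset.sum_congr rfl fun j _ => by ring

theorem Matrix.natDegree_regressionPolynomial_le {q : ℕ}
    (A : Matrix (Fin (q + 1)) (Fin (q + 1)) ℝ) : A.regressionPolynomial.natDegree ≤ 2 * q :=
  Polynomial.natDegree_sum_le_of_forall_le _ _ fun i _ =>
    Polynomial.natDegree_sum_le_of_forall_le _ _ fun j _ =>
      (Polynomial.natDegree_C_mul_X_pow_le _ _).trans (by omega)

/-- Only `i = j = q` reaches exponent `2 * q`. -/
theorem Matrix.coeff_regressionPolynomial {q : ℕ} (A : Matrix (Fin (q + 1)) (Fin (q + 1)) ℝ) :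
    A.regressionPolynomial.coeff (2 * q) = A (Fin.last q) (Fin.last q) := by
  simp only [Matrix.regressionPolynomial, Polynomial.finsetSum_coeff, Polynomial.coeff_C_mul_X_pow]
  rw [Finset.sum_eq_single (Fin.last q), Finset.sum_eq_single (Fin.last q)]
  · simp [two_mul]
  · intro j _ hj
    have := Fin.val_lt_last hj
    rw [if_neg]
    simp only [Fin.val_last]
    omega
  · simp
  · intro i _ hi
    have := Fin.val_lt_last hi
    refine Finset.sum_eq_zero fun j _ => ?_
    rw [if_neg]
    omega
  · simp

/-- With `A = α M(ξ)⁻¹` this turns `∫ ψ(x, ξ) dη` into the trace occurring in the derivative of `log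
det`. -/
theorem Matrix.integral_regressionPolynomial {q : ℕ} (A : Matrix (Fin (q + 1)) (Fin (q + 1)) ℝ)
    {η : Measure ℝ} (hη : ∀ k ≤ 2 * q, Integrable (fun x => x ^ k) η) :
    ∫ x, A.regressionPolynomial.eval x ∂η = (A * informationMatrix q η).trace := by
  have hint : ∀ i j : Fin (q + 1), Integrable (fun x : ℝ => A i j * x ^ ((i : ℕ) + j)) η :=
    fun i j => (hη _ (by omega)).const_mul _
  simp only [Matrix.regressionPolynomial, Polynomial.eval_finsetSum, Polynomial.eval_mul,
    Polynomial.eval_C, Polynomial.eval_pow, Polynomial.eval_X, Matrix.trace, Matrix.diag,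
    Matrix.mul_apply, informationMatrix, Matrix.of_apply, regressionVector]
  rw [integral_finsetSum _ fun i _ => integrable_finsetSum _ fun j _ => hint i j]
  refine Finset.sum_congr rfl fun i _ => ?_
  rw [integral_finsetSum _ fun j _ => hint i j]
  refine Finset.sum_congr rfl fun j _ => ?_
  rw [integral_const_mul]
  congr 2
  ext x
  ring

theorem sensitivity_eq_eval (q : ℕ) (α : ℝ) (ξ : Measure ℝ) (x : ℝ) :
    sensitivity q α ξ x = (α • (informationMatrix q ξ)⁻¹).regressionPolynomial.eval x := by
  rw [Matrix.eval_regressionPolynomial, Matrix.smul_mulVec, dotProduct_smul, smul_eq_mul]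
  rfl

/-- The quadratic form at `v` is `∫ p² dξ`, where `p` has coefficient vector `v`. The finitely many
roots of `p ≠ 0` are null for `ξ`, so the integral is positive. -/
theorem informationMatrix_posDef {q : ℕ} {ξ : Measure ℝ}
    (hξ : ∀ k ≤ 2 * q, Integrable (fun x => x ^ k) ξ) (hac : ξ ≪ volume) (hne : ξ ≠ 0) :
    (informationMatrix q ξ).PosDef := by
  refine Matrix.PosDef.of_dotProduct_mulVec_pos ?_ fun v hv => ?_
  · ext i j
    simp [informationMatrix, mul_comm]
  let p : Polynomial ℝ := ∑ i : Fin (q + 1), Polynomial.C (v i) * Polynomial.X ^ (i : ℕ)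
  have hpeval : ∀ x, p.eval x = ∑ i, v i * x ^ (i : ℕ) := fun x => by
    simp [p, Polynomial.eval_finsetSum]
  have hp : p ≠ 0 := by
    obtain ⟨i, hi⟩ := Function.ne_iff.1 hv
    intro h
    apply hi
    have := congrArg (fun r => Polynomial.coeff r i) h
    simpa [p, Polynomial.finsetSum_coeff, Polynomial.coeff_C_mul_X_pow, Fin.val_inj] using this
  have hsq : ∀ x, (Matrix.vecMulVec v v).regressionPolynomial.eval x = p.eval x ^ 2 := fun x => by
    rw [hpeval, sq, Finset.sum_mul_sum]
    simp only [Matrix.regressionPolynomial, Polynomial.eval_finsetSum, Polynomial.eval_mul,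
      Polynomial.eval_C, Polynomial.eval_pow, Polynomial.eval_X, Matrix.vecMulVec_apply]
    exact Finset.sum_congr rfl fun i _ => Finset.sum_congr rfl fun j _ => by ring
  have htr : star v ⬝ᵥ (informationMatrix q ξ).mulVec v = ∫ x, p.eval x ^ 2 ∂ξ := by
    simp only [← hsq]
    rw [Matrix.integral_regressionPolynomial _ hξ, Matrix.vecMulVec_mul, Matrix.trace_vecMulVec,
      star_trivial, Matrix.dotProduct_mulVec, dotProduct_comm]
  rw [htr, integral_pos_iff_support_of_nonneg (fun x => sq_nonneg _)]
  · have h0 : ξ {x | p.IsRoot x} = 0 := hac ((p.finite_setOfPred_isRoot hp).measure_zero _)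
    have h1 : Function.support (fun x => p.eval x ^ 2) = {x | p.IsRoot x}ᶜ := by
      ext x; simp [Polynomial.IsRoot]
    rw [h1, measure_of_measure_compl_eq_zero (by rwa [compl_compl])]
    exact pos_iff_ne_zero.2 (by simpa using hne)
  · simp only [← hsq]
    exact Polynomial.integrable_eval_of_moments hξ (Matrix.natDegree_regressionPolynomial_le _)

/-! ### Subsampling designs: moments, bathtub inequality, convexity. -/

theorem IsSubsamplingDesign.integrable_pow {q : ℕ} {fX : ℝ → ℝ} {α : ℝ} {ξ : Measure ℝ}
    (hξ : IsSubsamplingDesign fX α ξ) (hfX_meas : Measurable fX) (hfX_nonneg : ∀ x, 0 ≤ fX x)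
    (hfX_int : Integrable fX) (hmom : Integrable fun x => x ^ (2 * q) * fX x) :
    ∀ k ≤ 2 * q, Integrable (fun x => x ^ k) ξ := by
  intro k hk
  obtain ⟨f, -, -, hle, rfl⟩ := hξ.exists_density
  exact ((integrable_withDensity_ofReal_iff hfX_meas hfX_nonneg).2
    (integrable_mul_pow hfX_meas hfX_nonneg hfX_int hmom hk)).mono_measure
      (withDensity_mono (Filter.Eventually.of_forall fun x => ENNReal.ofReal_le_ofReal (hle x)))

theorem IsSubsamplingDesign.posDef {q : ℕ} {fX : ℝ → ℝ} {α : ℝ} {ξ : Measure ℝ}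
    (hξ : IsSubsamplingDesign fX α ξ) (hα : 0 < α)
    (hmom : ∀ k ≤ 2 * q, Integrable (fun x => x ^ k) ξ) : (informationMatrix q ξ).PosDef := by
  refine informationMatrix_posDef hmom ?_ ?_
  · obtain ⟨f, -, -, -, rfl⟩ := hξ.exists_density
    exact withDensity_absolutelyContinuous _ _
  · rintro rfl
    have := hξ.mass_eq
    simp at this
    linarith

theorem integral_eq_of_withDensity_univ {α : ℝ} (hα : 0 ≤ α) {f : ℝ → ℝ}
    (h0 : ∀ x, 0 ≤ f x) (hf : Integrable f)
    (hξ : (volume.withDensity fun x => ENNReal.ofReal (f x)) univ = ENNReal.ofReal α) :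
    ∫ x, f x = α := by
  rw [withDensity_ofReal_univ h0 hf] at hξ
  exact (ENNReal.ofReal_eq_ofReal_iff (integral_nonneg h0) hα).1 hξ

/-- Designs with density above a threshold of the sensitivity function are optimal for the
linearised problem. -/
theorem integral_le_of_indicator {g fX w : ℝ → ℝ} {S : Set ℝ} {s : ℝ} (hg0 : ∀ x, 0 ≤ g x)
    (hg : ∀ x, g x ≤ fX x) (hgi : Integrable g) (hSi : Integrable (S.indicator fX))
    (hgw : Integrable fun x => g x * w x) (hSw : Integrable fun x => S.indicator fX x * w x)
    (hmass : ∫ x, g x = ∫ x, S.indicator fX x) (hin : ∀ x ∈ S, s ≤ w x)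
    (hout : ∀ x, x ∉ S → w x < s) :
    ∫ x, g x * w x ≤ ∫ x, S.indicator fX x * w x := by
  -- Pointwise `(g - 1_S fX)(w - s) ≤ 0`; the terms with `s` cancel because the masses agree.
  have h1 : ∫ x, (g x * w x - g x * s) ≤ ∫ x, (S.indicator fX x * w x - S.indicator fX x * s) := by
    refine integral_mono (hgw.sub (hgi.mul_const s)) (hSw.sub (hSi.mul_const s)) fun x => ?_
    by_cases hx : x ∈ S
    · simp only [indicator_of_mem hx]
      nlinarith [mul_nonneg (sub_nonneg.2 (hg x)) (sub_nonneg.2 (hin x hx))]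
    · simp only [indicator_of_notMem hx]
      nlinarith [mul_nonneg (hg0 x) (sub_nonneg.2 (hout x hx).le)]
  rw [integral_sub hgw (hgi.mul_const s), integral_sub hSw (hSi.mul_const s), integral_mul_const,
    integral_mul_const, hmass] at h1
  linarith

theorem informationMatrix_withDensity_convex {q : ℕ} {f g : ℝ → ℝ} {t : ℝ} (hf : Measurable f)
    (hg : Measurable g) (hf0 : ∀ x, 0 ≤ f x) (hg0 : ∀ x, 0 ≤ g x) (ht : t ∈ Ioo (0 : ℝ) 1)
    (hfm : ∀ k ≤ 2 * q, Integrable fun x => f x * x ^ k)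
    (hgm : ∀ k ≤ 2 * q, Integrable fun x => g x * x ^ k) :
    informationMatrix q
        (volume.withDensity fun x => ENNReal.ofReal ((1 - t) * f x + t * g x)) =
      informationMatrix q (volume.withDensity fun x => ENNReal.ofReal (f x)) +
        t • (informationMatrix q (volume.withDensity fun x => ENNReal.ofReal (g x)) -
          informationMatrix q (volume.withDensity fun x => ENNReal.ofReal (f x))) := by
  have hh0 : ∀ x, 0 ≤ (1 - t) * f x + t * g x := fun x =>
    add_nonneg (mul_nonneg (sub_nonneg.2 ht.2.le) (hf0 x)) (mul_nonneg ht.1.le (hg0 x))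
  ext i j
  simp only [informationMatrix, Matrix.of_apply, Matrix.add_apply, Matrix.smul_apply,
    Matrix.sub_apply, smul_eq_mul, regressionVector, ← pow_add]
  rw [integral_withDensity_ofReal (by fun_prop) hh0, integral_withDensity_ofReal hf hf0,
    integral_withDensity_ofReal hg hg0]
  have h1 := hfm ((i : ℕ) + j) (by omega)
  have h2 := hgm ((i : ℕ) + j) (by omega)
  calc _ = ∫ x, ((1 - t) * (f x * x ^ ((i : ℕ) + j)) + t * (g x * x ^ ((i : ℕ) + j))) :=
        integral_congr_ae (Filter.Eventually.of_forall fun x => by ring)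
    _ = _ := by
      rw [integral_add (h1.const_mul _) (h2.const_mul _), integral_const_mul, integral_const_mul]
      ring

theorem IsSubsamplingDesign.convex {fX f g : ℝ → ℝ} {α t : ℝ} (ht : t ∈ Ioo (0 : ℝ) 1)
    (hf : Measurable f) (hg : Measurable g) (hf0 : ∀ x, 0 ≤ f x) (hg0 : ∀ x, 0 ≤ g x)
    (hfX : ∀ x, f x ≤ fX x) (hgX : ∀ x, g x ≤ fX x) (hfi : Integrable f) (hgi : Integrable g)
    (hfα : ∫ x, f x = α) (hgα : ∫ x, g x = α) :
    IsSubsamplingDesign fX α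
      (volume.withDensity fun x => ENNReal.ofReal ((1 - t) * f x + t * g x)) := by
  have hh0 : ∀ x, 0 ≤ (1 - t) * f x + t * g x := fun x =>
    add_nonneg (mul_nonneg (sub_nonneg.2 ht.2.le) (hf0 x)) (mul_nonneg ht.1.le (hg0 x))
  refine ⟨⟨fun x => (1 - t) * f x + t * g x, by fun_prop, hh0, fun x => ?_, rfl⟩, ?_⟩
  · nlinarith [mul_le_mul_of_nonneg_left (hfX x) (sub_nonneg.2 ht.2.le),
      mul_le_mul_of_nonneg_left (hgX x) ht.1.le]
  · rw [withDensity_ofReal_univ hh0 ((hfi.const_mul _).add (hgi.const_mul _)),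
      integral_add (hfi.const_mul _) (hgi.const_mul _), integral_const_mul, integral_const_mul,
      hfα, hgα]
    congr 1
    ring

/-! ### Reduction of D-optimality to the linearised problem. -/

/-- An optimal design maximises the integral of its own sensitivity function. -/
theorem IsDOptimal.integral_sensitivity_le {q : ℕ} {fX : ℝ → ℝ} {α : ℝ} {ξ η : Measure ℝ}
    (hopt : IsDOptimal q fX α ξ) (hη : IsSubsamplingDesign fX α η) (hα : 0 < α)
    (hfX_meas : Measurable fX) (hfX_nonneg : ∀ x, 0 ≤ fX x) (hfX_int : Integrable fX)
    (hmom : Integrable fun x => x ^ (2 * q) * fX x) :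
    ∫ x, sensitivity q α ξ x ∂η ≤ ∫ x, sensitivity q α ξ x ∂ξ := by
  have hdes : ∀ ζ, IsSubsamplingDesign fX α ζ → ∀ k ≤ 2 * q, Integrable (fun x => x ^ k) ζ :=
    fun ζ hζ => hζ.integrable_pow hfX_meas hfX_nonneg hfX_int hmom
  have hξ := hopt.1
  have hM := hξ.posDef hα (hdes ξ hξ)
  have htr : ((informationMatrix q ξ)⁻¹ *
      (informationMatrix q η - informationMatrix q ξ)).trace ≤ 0 := by
    -- Mixtures of `ξ` and `η` are again designs, and their information matrices run along the
    -- segment from `M(ξ)` to `M(η)`.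
    refine Matrix.trace_inv_mul_sub_nonpos_of_det_le hM.det_pos fun t ht => ?_
    obtain ⟨f, hf, hf0, hfX, hξf⟩ := hξ.exists_density
    obtain ⟨g, hg, hg0, hgX, hηg⟩ := hη.exists_density
    have hfi : Integrable f := hfX_int.mono' hf.aestronglyMeasurable
      (Filter.Eventually.of_forall fun x => by simpa [abs_of_nonneg (hf0 x)] using hfX x)
    have hgi : Integrable g := hfX_int.mono' hg.aestronglyMeasurable
      (Filter.Eventually.of_forall fun x => by simpa [abs_of_nonneg (hg0 x)] using hgX x)
    have hfα := integral_eq_of_withDensity_univ hα.le hf0 hfi (hξf ▸ hξ.mass_eq)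
    have hgα := integral_eq_of_withDensity_univ hα.le hg0 hgi (hηg ▸ hη.mass_eq)
    have hfm : ∀ k ≤ 2 * q, Integrable fun x => f x * x ^ k := fun k hk =>
      (integrable_withDensity_ofReal_iff hf hf0).1 (hξf ▸ hdes ξ hξ k hk)
    have hgm : ∀ k ≤ 2 * q, Integrable fun x => g x * x ^ k := fun k hk =>
      (integrable_withDensity_ofReal_iff hg hg0).1 (hηg ▸ hdes η hη k hk)
    have hζ := IsSubsamplingDesign.convex ht hf hg hf0 hg0 hfX hgX hfi hgi hfα hgα
    have hle := hopt.2 _ hζ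
    have hpos := (hζ.posDef hα (hdes _ hζ)).det_pos
    rw [dCriterion, dCriterion, Real.log_le_log_iff hpos hM.det_pos,
      informationMatrix_withDensity_convex hf hg hf0 hg0 ht hfm hgm, ← hξf, ← hηg] at hle
    exact hle
  simp only [sensitivity_eq_eval]
  rw [Matrix.integral_regressionPolynomial _ (hdes η hη),
    Matrix.integral_regressionPolynomial _ (hdes ξ hξ), Matrix.smul_mul, Matrix.smul_mul,
    Matrix.trace_smul, Matrix.trace_smul, smul_eq_mul, smul_eq_mul]
  rw [Matrix.mul_sub, Matrix.trace_sub] at htr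
  exact mul_le_mul_of_nonneg_left (by linarith) hα.le

/-- A design maximising the integral of its own sensitivity function is optimal. -/
theorem isDOptimal_of_integral_sensitivity_le {q : ℕ} {fX : ℝ → ℝ} {α : ℝ} {ξ : Measure ℝ}
    (hξ : IsSubsamplingDesign fX α ξ) (hα : 0 < α)
    (hfX_meas : Measurable fX) (hfX_nonneg : ∀ x, 0 ≤ fX x) (hfX_int : Integrable fX)
    (hmom : Integrable fun x => x ^ (2 * q) * fX x)
    (h : ∀ η, IsSubsamplingDesign fX α η →
      ∫ x, sensitivity q α ξ x ∂η ≤ ∫ x, sensitivity q α ξ x ∂ξ) :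
    IsDOptimal q fX α ξ := by
  have hdes : ∀ ζ, IsSubsamplingDesign fX α ζ → ∀ k ≤ 2 * q, Integrable (fun x => x ^ k) ζ :=
    fun ζ hζ => hζ.integrable_pow hfX_meas hfX_nonneg hfX_int hmom
  refine ⟨hξ, fun η hη => ?_⟩
  have hM := hξ.posDef hα (hdes ξ hξ)
  -- The dimension term cancels against `tr (M(ξ)⁻¹ M(ξ))`.
  have hlog := hM.log_det_le (hη.posDef hα (hdes η hη))
  have hle := h η hη
  simp only [sensitivity_eq_eval] at hle
  rw [Matrix.integral_regressionPolynomial _ (hdes η hη),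
    Matrix.integral_regressionPolynomial _ (hdes ξ hξ), Matrix.smul_mul, Matrix.smul_mul,
    Matrix.trace_smul, Matrix.trace_smul, smul_eq_mul, smul_eq_mul,
    Matrix.nonsing_inv_mul _ hM.det_pos.ne'.isUnit, Matrix.trace_one] at hle
  have := le_of_mul_le_mul_left hle hα
  unfold dCriterion
  linarith

/-! ### Solution and uniqueness of the bathtub problem. -/

/-- Superlevel sets of a function without atoms can be given any prescribed mass. -/
theorem exists_integral_indicator_superlevel_eq {fX w : ℝ → ℝ} {α : ℝ} (hα0 : 0 < α) (hα1 : α ≤ 1)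
    (hfX_meas : Measurable fX) (hfX_nonneg : ∀ x, 0 ≤ fX x) (hfX_int : Integrable fX)
    (hfX_one : ∫ x, fX x = 1) (hw : Measurable w) (hw0 : ∀ x, 0 ≤ w x)
    (hwi : Integrable fun x => fX x * w x) (hlevel : ∀ s, volume {x | w x = s} = 0) :
    ∃ s, ∫ x, {x | s ≤ w x}.indicator fX x = α := by
  -- Dominated convergence: for `w x ≠ s₀` the integrand is locally constant in the threshold near
  -- `s₀`, and the remaining `x` form a null level set.
  have hcont : Continuous fun s => ∫ x, {x | s ≤ w x}.indicator fX x := by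
    refine continuous_iff_continuousAt.2 fun s₀ => ?_
    refine continuousAt_of_dominated (bound := fX) ?_ ?_ hfX_int ?_
    · exact Filter.Eventually.of_forall fun s =>
        (hfX_meas.indicator (measurableSet_le measurable_const hw)).aestronglyMeasurable
    · refine Filter.Eventually.of_forall fun s => Filter.Eventually.of_forall fun x => ?_
      rw [Real.norm_of_nonneg (indicator_nonneg (fun x _ => hfX_nonneg x) x)]
      exact indicator_le_self' (fun x _ => hfX_nonneg x) x
    · filter_upwards [compl_mem_ae_iff.2 (hlevel s₀)] with x hx
      have hx' : w x ≠ s₀ := hx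
      rcases lt_or_gt_of_ne hx' with h | h
      · refine (continuousAt_const (y := (0 : ℝ))).congr ?_
        filter_upwards [lt_mem_nhds h] with s hs
        rw [indicator_of_notMem]
        exact not_le.2 hs
      · refine (continuousAt_const (y := fX x)).congr ?_
        filter_upwards [gt_mem_nhds h] with s hs
        rw [indicator_of_mem]
        exact hs.le
  have hzero : α ≤ ∫ x, {x | 0 ≤ w x}.indicator fX x := by
    have : {x | 0 ≤ w x} = univ := eq_univ_of_forall hw0
    rw [this, indicator_univ, hfX_one]
    exact hα1
  -- Markov's inequality bounds the mass of `{T ≤ w}` by `(∫ fX w) / T ≤ α`; the summand 1 keeps `T`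
  -- positive.
  set T := (∫ x, fX x * w x) / α + 1
  have hT : 0 < T := by
    have : 0 ≤ ∫ x, fX x * w x := integral_nonneg fun x => mul_nonneg (hfX_nonneg x) (hw0 x)
    positivity
  have hlarge : ∫ x, {x | T ≤ w x}.indicator fX x ≤ α := by
    have h1 : ∫ x, T * {x | T ≤ w x}.indicator fX x ≤ ∫ x, fX x * w x := by
      refine integral_mono
        ((hfX_int.indicator (measurableSet_le measurable_const hw)).const_mul T) hwi fun x => ?_
      by_cases hx : T ≤ w x
      · simp only [indicator_of_mem (show x ∈ {x | T ≤ w x} from hx)]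
        rw [mul_comm]
        exact mul_le_mul_of_nonneg_left hx (hfX_nonneg x)
      · simp only [indicator_of_notMem (show x ∉ {x | T ≤ w x} from hx), mul_zero]
        exact mul_nonneg (hfX_nonneg x) (hw0 x)
    rw [integral_const_mul] at h1
    have h2 : ∫ x, fX x * w x ≤ T * α := by
      have : T * α = (∫ x, fX x * w x) + α := by simp only [T]; field_simp
      linarith
    exact le_of_mul_le_mul_left (h1.trans h2) hT
  obtain ⟨s, -, hs⟩ := intermediate_value_Icc' hT.le hcont.continuousOn ⟨hlarge, hzero⟩
  exact ⟨s, hs⟩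

/-- Uniqueness of the maximiser of the linearised problem. -/
theorem ae_eq_indicator_of_integral_le {f fX w : ℝ → ℝ} {s : ℝ} (hf0 : ∀ x, 0 ≤ f x)
    (hf : ∀ x, f x ≤ fX x) (hfi : Integrable f)
    (hSi : Integrable ({x | s ≤ w x}.indicator fX)) (hfw : Integrable fun x => f x * w x)
    (hSw : Integrable fun x => {x | s ≤ w x}.indicator fX x * w x)
    (hmass : ∫ x, f x = ∫ x, {x | s ≤ w x}.indicator fX x)
    (hle : ∫ x, {x | s ≤ w x}.indicator fX x * w x ≤ ∫ x, f x * w x)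
    (hlevel : volume {x | w x = s} = 0) :
    f =ᵐ[volume] {x | s ≤ w x}.indicator fX := by
  -- `d = (1_S fX - f)(w - s)` with `S = {s ≤ w}` is nonnegative with integral at most 0, hence zero
  -- almost everywhere, while `w ≠ s` almost everywhere.
  set d : ℝ → ℝ := fun x => ({x | s ≤ w x}.indicator fX x * w x - f x * w x) -
    ({x | s ≤ w x}.indicator fX x * s - f x * s)
  have hd0 : ∀ x, 0 ≤ d x := fun x => by
    by_cases hx : s ≤ w x
    · simp only [d, indicator_of_mem (show x ∈ {x | s ≤ w x} from hx)]
      nlinarith [mul_nonneg (sub_nonneg.2 (hf x)) (sub_nonneg.2 hx)]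
    · simp only [d, indicator_of_notMem (show x ∉ {x | s ≤ w x} from hx)]
      nlinarith [mul_nonneg (hf0 x) (sub_nonneg.2 (not_le.1 hx).le)]
  have hdi : Integrable d :=
    (hSw.sub hfw).sub ((hSi.mul_const s).sub (hfi.mul_const s))
  have hdint : ∫ x, d x = 0 := by
    refine le_antisymm ?_ (integral_nonneg hd0)
    have hsub := (integral_sub (hSw.sub hfw) ((hSi.mul_const s).sub (hfi.mul_const s))).trans
      (congrArg₂ (· - ·) (integral_sub hSw hfw)
        (integral_sub (hSi.mul_const s) (hfi.mul_const s)))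
    rw [integral_mul_const, integral_mul_const, hmass] at hsub
    refine hsub.le.trans ?_
    linarith
  have hae := (integral_eq_zero_iff_of_nonneg_ae (Filter.Eventually.of_forall hd0) hdi).1 hdint
  filter_upwards [hae, compl_mem_ae_iff.2 hlevel] with x hx hxs
  have h1 : ({x | s ≤ w x}.indicator fX x - f x) * (w x - s) = 0 := by
    have : d x = 0 := hx
    simp only [d] at this
    linarith
  rcases mul_eq_zero.1 h1 with h | h
  · linarith
  · exact absurd (sub_eq_zero.1 h) hxs

/-! ### The characterisation of D-optimal designs. -/

theorem mainTheorem1 (q : ℕ) (hq : 1 ≤ q) (α : ℝ) (hα0 : 0 < α) (hα1 : α < 1)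
    (fX : ℝ → ℝ) (hfX_meas : Measurable fX) (hfX_nonneg : ∀ x, 0 ≤ fX x)
    (hfX_int : Integrable fX volume) (hfX_one : ∫ x, fX x = 1)
    (hfX_moment : Integrable (fun x => x ^ (2 * q) * fX x) volume)
    (ξ : Measure ℝ) (hξ : IsSubsamplingDesign fX α ξ) :
    IsDOptimal q fX α ξ ↔
      ∃ (s : ℝ) (r : ℕ) (a : ℕ → ℝ),
        1 ≤ r ∧ r ≤ q ∧ IsBoundary r a ∧
        (Iic r).PairwiseDisjoint (supportInterval r a) ∧
        ξ = volume.withDensity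
          (fun x => ENNReal.ofReal ((supportSet r a).indicator fX x)) ∧
        (∀ x ∈ supportSet r a, s ≤ sensitivity q α ξ x) ∧
        (∀ x, x ∉ supportSet r a → sensitivity q α ξ x < s) := by
  have hfXm : ∀ k ≤ 2 * q, Integrable (fun x => x ^ k)
      (volume.withDensity fun x => ENNReal.ofReal (fX x)) := fun k hk =>
    (integrable_withDensity_ofReal_iff hfX_meas hfX_nonneg).2
      (integrable_mul_pow hfX_meas hfX_nonneg hfX_int hfX_moment hk)
  have hξm := hξ.integrable_pow hfX_meas hfX_nonneg hfX_int hfX_moment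
  have hM := hξ.posDef hα0 hξm
  set P := (α • (informationMatrix q ξ)⁻¹).regressionPolynomial
  have hψ : sensitivity q α ξ = fun x => P.eval x := funext (sensitivity_eq_eval q α ξ)
  have hψm : Measurable (sensitivity q α ξ) := by rw [hψ]; exact P.continuous.measurable
  have hψi : Integrable (fun x => fX x * sensitivity q α ξ x) := by
    rw [hψ]
    exact (integrable_withDensity_ofReal_iff hfX_meas hfX_nonneg).1
      (Polynomial.integrable_eval_of_moments hfXm (Matrix.natDegree_regressionPolynomial_le _))
  have hdom : ∀ g : ℝ → ℝ, Measurable g → (∀ x, 0 ≤ g x) → (∀ x, g x ≤ fX x) →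
      Integrable g ∧ Integrable fun x => g x * sensitivity q α ξ x := by
    refine fun g hg hg0 hgX => ⟨hfX_int.mono' hg.aestronglyMeasurable
      (Filter.Eventually.of_forall fun x => by simpa [abs_of_nonneg (hg0 x)] using hgX x),
      hψi.mono (hg.mul hψm).aestronglyMeasurable (Filter.Eventually.of_forall fun x => ?_)⟩
    rw [norm_mul, norm_mul, Real.norm_of_nonneg (hg0 x), Real.norm_of_nonneg (hfX_nonneg x)]
    exact mul_le_mul_of_nonneg_right (hgX x) (norm_nonneg _)
  have hind0 : ∀ (S : Set ℝ) x, 0 ≤ S.indicator fX x := fun S x =>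
    indicator_nonneg (fun x _ => hfX_nonneg x) x
  have hindX : ∀ (S : Set ℝ) x, S.indicator fX x ≤ fX x := fun S x =>
    indicator_le_self' (fun x _ => hfX_nonneg x) x
  constructor
  · intro hopt
    -- The leading coefficient is `α` times a diagonal entry of the positive definite `M(ξ)⁻¹`.
    have hcoeff : 0 < P.coeff (2 * q) := by
      rw [Matrix.coeff_regressionPolynomial, Matrix.smul_apply, smul_eq_mul]
      exact mul_pos hα0 hM.inv.diag_pos
    have hdeg : P.natDegree = 2 * q := le_antisymm (Matrix.natDegree_regressionPolynomial_le _)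
      (Polynomial.le_natDegree_of_ne_zero hcoeff.ne')
    have hPs : ∀ s, (P - Polynomial.C s).natDegree = 2 * q := fun s => by
      rw [Polynomial.natDegree_sub_C, hdeg]
    have hlead : ∀ s, 0 < (P - Polynomial.C s).leadingCoeff := fun s => by
      rw [Polynomial.leadingCoeff, hPs, Polynomial.coeff_sub, Polynomial.coeff_C_of_ne_zero (by omega),
        sub_zero]
      exact hcoeff
    have hlevel : ∀ s, volume {x | sensitivity q α ξ x = s} = 0 := fun s => by
      have hne : P - Polynomial.C s ≠ 0 := by
        intro h
        have := hlead s
        simp [h] at this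
      have : {x | sensitivity q α ξ x = s} = {x | (P - Polynomial.C s).IsRoot x} := by
        ext x
        simp [hψ, Polynomial.IsRoot, sub_eq_zero]
      rw [this]
      exact (Polynomial.finite_setOfPred_isRoot hne).measure_zero _
    have hψ0 : ∀ x, 0 ≤ sensitivity q α ξ x := fun x =>
      mul_nonneg hα0.le (by
        simpa using hM.inv.posSemidef.dotProduct_mulVec_nonneg (regressionVector q x))
    obtain ⟨s, hs⟩ := exists_integral_indicator_superlevel_eq hα0 hα1.le hfX_meas hfX_nonneg hfX_int
      hfX_one hψm hψ0 hψi hlevel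
    -- The competitor for `ξ` is the bathtub solution for the sensitivity function of `ξ` itself;
    -- uniqueness then forces the two to coincide.
    set S := {x | s ≤ sensitivity q α ξ x}
    have hSmeas : MeasurableSet S := measurableSet_le measurable_const hψm
    obtain ⟨hSi, hSψ⟩ := hdom _ (hfX_meas.indicator hSmeas) (hind0 S) (hindX S)
    have hη : IsSubsamplingDesign fX α
        (volume.withDensity fun x => ENNReal.ofReal (S.indicator fX x)) :=
      ⟨⟨_, hfX_meas.indicator hSmeas, hind0 S, hindX S, rfl⟩, by
        rw [withDensity_ofReal_univ (hind0 S) hSi, hs]⟩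
    have hle := hopt.integral_sensitivity_le hη hα0 hfX_meas hfX_nonneg hfX_int hfX_moment
    obtain ⟨f, hf, hf0, hfX, hξf⟩ := hξ.exists_density
    obtain ⟨hfi, hfψ⟩ := hdom f hf hf0 hfX
    have hfα := integral_eq_of_withDensity_univ hα0.le hf0 hfi (hξf ▸ hξ.mass_eq)
    have hle' : ∫ x, S.indicator fX x * sensitivity q α ξ x ≤ ∫ x, f x * sensitivity q α ξ x := by
      rw [← integral_withDensity_ofReal (hfX_meas.indicator hSmeas) (hind0 S),
        ← integral_withDensity_ofReal hf hf0, ← hξf]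
      exact hle
    have hae : f =ᵐ[volume] S.indicator fX := ae_eq_indicator_of_integral_le hf0 hfX hfi hSi hfψ hSψ
      (hfα.trans hs.symm) hle' (hlevel s)
    -- This is where `α < 1` enters: without a gap, `S` would be the whole line and carry mass 1.
    have hneg : ∃ x, (P - Polynomial.C s).eval x < 0 := by
      by_contra! h
      have : S = univ := eq_univ_of_forall fun x => by
        have := h x
        simp only [Polynomial.eval_sub, Polynomial.eval_C] at this
        simp only [S, hψ, mem_ofPred_eq]
        linarith
      rw [this, indicator_univ, hfX_one] at hs
      linarith
    obtain ⟨r, a, hr1, hrq, ha, hiff⟩ :=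
      Polynomial.exists_boundary_of_eval_neg q (hPs s) (hlead s) hneg
    have hmem : ∀ x, x ∉ supportSet r a ↔ sensitivity q α ξ x < s := fun x => by
      rw [ha.notMem_supportSet_iff hr1, ← hiff]
      simp [hψ]
    have hSeq : supportSet r a = S := by
      ext x
      rw [← not_iff_not, hmem]
      simp [S]
    refine ⟨s, r, a, hr1, hrq, ha, ha.pairwiseDisjoint, ?_, fun x hx => ?_, fun x => (hmem x).1⟩
    · rw [hSeq]
      refine hξf.trans (withDensity_congr_ae ?_)
      filter_upwards [hae] with x hx
      rw [hx]
    · rw [hSeq] at hx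
      exact hx
  -- Conversely, the bathtub inequality shows that `ξ` maximises the linearised functional, and
  -- concavity gives optimality.
  · rintro ⟨s, r, a, -, -, -, -, hξa, hin, hout⟩
    refine isDOptimal_of_integral_sensitivity_le hξ hα0 hfX_meas hfX_nonneg hfX_int hfX_moment
      fun η hη => ?_
    have hSmeas := measurableSet_supportSet r a
    obtain ⟨hSi, hSψ⟩ := hdom _ (hfX_meas.indicator hSmeas) (hind0 _) (hindX _)
    obtain ⟨g, hg, hg0, hgX, hηg⟩ := hη.exists_density
    obtain ⟨hgi, hgψ⟩ := hdom g hg hg0 hgX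
    have hgα := integral_eq_of_withDensity_univ hα0.le hg0 hgi (hηg ▸ hη.mass_eq)
    have hSα := integral_eq_of_withDensity_univ hα0.le (hind0 _) hSi (hξa ▸ hξ.mass_eq)
    calc _ = ∫ x, g x * sensitivity q α ξ x := by
          rw [hηg, integral_withDensity_ofReal hg hg0]
      _ ≤ ∫ x, (supportSet r a).indicator fX x * sensitivity q α ξ x :=
          integral_le_of_indicator hg0 hgX hgi hSi hgψ hSψ (hgα.trans hSα.symm) hin hout
      _ = ∫ x, sensitivity q α ξ x ∂(volume.withDensity fun x =>
            ENNReal.ofReal ((supportSet r a).indicator fX x)) :=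
          (integral_withDensity_ofReal (hfX_meas.indicator hSmeas) (hind0 _) _).symm
      _ = _ := by rw [← hξa]
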